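/- **Diagrams and corners.** For integers $0\le k\le n$, a $(k,n)$-diagram is a left-justified diagram of boxes (cells) in a $k\times(n-k)$ rectangle with $\lambda_i$ boxes in row $i$, where $n-k\ge\lambda_1\ge\lambda_2\ge\dots\ge\lambda_k\ge 0$. Empty rows and empty columns are allowed unless excluded below. Its length is $n$, the number of rows plus the number of columns. Its South-East border is the lattice path running along the boundary of the diagram from the North-East to the South-West corner of the rectangle. A corner is a cell whose right edge and bottom edge both belong to this border. **Tableaux.** - A *permutation tableau* is a $(k,n)$-diagram with no empty column, with every cell filled with $0$ or $1$, such that each column contains at least one $1$ and no $0$ has both a $1$ above it in the same column and a $1$ to its left in the same row. Let $\mathcal{PT}_n$ be the set of permutation tableaux of length $n$. - An *alternative tableau* is a $(k,n)$-diagram with a partial filling of the cells with symbols $\leftarrow$ and $\uparrow$ such that all cells to the left of a $\leftarrow$ in the same row, and all cells above an $\uparrow$ in the same column, are empty. Let $\mathcal{AT}_n$ be the set of alternative tableaux of length $n$. - A *tree-like tableau* is a $(k,n)$-diagram with no empty rows and no empty columns, some of whose cells contain a point, such that: the top left cell contains a point (the root); every other pointed cell has a pointed cell above it in the same column or a pointed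 cell to its left in the same row, but not both; every row and every column contains at least one point. Its size is its number of points. Let $\mathcal{T}_n$ be the set of tree-like tableaux of size $n$. For a set $X$ of tableaux, let $c(X)$ denote the total number of corners of the tableaux in $X$, that is, the number of pairs $(T,c)$ with $T\in X$ and $c$ a corner of $T$. **Theorem.** For every integer $n\ge 1$ the numbers $c(\mathcal{PT}_n)$, $c(\mathcal{AT}_{n-1})$ and $c(\mathcal{T}_n)$ are finite, and $$c(\mathcal{PT}_n)=\begin{cases}0,& n=1,\\ (n-1)!\cdot\dfrac{n^2+4n-6}{6},& n\ge 2,\end{cases}$$ $$c(\mathcal{AT}_{n-1})=\begin{cases}0,& n=1,\\ (n-1)!\cdot\dfrac{n^2+4n-12}{6},& n\ge 2,\end{cases}$$ $$c(\mathcal{T}_{n})=\begin{cases}1,& n=1,\\ n!\cdot\dfrac{n+4}{6},& n\ge 2.\end{cases}$$ -/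

import Mathlib

namespace TypeATableaux

/-- A `(k,n)`-diagram, `k ≤ n`: a left-justified diagram of boxes with weakly decreasing row
lengths, i.e. a Young diagram, placed in a `k × (n - k)` rectangle. Rows and columns of the
rectangle which meet no box (empty rows, empty columns) are allowed, and `k`, `n` are part of the
data. Rows `0, …, k-1` are numbered from top to bottom and columns `0, …, n-k-1` from left to right;
`(i, j)` is the box in row `i` and column `j`, and `shape.rowLen i` is the length of row `i`. -/
@[ext]
structure KNDiagram where
  k : ℕ
  n : ℕ
  k_le_n : k ≤ n
  shape : YoungDiagram
  colLen_le : shape.colLen 0 ≤ k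
  rowLen_le : shape.rowLen 0 ≤ n - k

/-- The number of columns of the enclosing rectangle. -/
def KNDiagram.numCols (D : KNDiagram) : ℕ := D.n - D.k

/-- The length of a diagram: its number of rows plus its number of columns. -/
def KNDiagram.length (D : KNDiagram) : ℕ := D.k + D.numCols

/-- A corner is a cell whose right edge and bottom edge belong to the South-East border. The border
edge of row `i` is the vertical unit segment at distance `rowLen i` from the left side, and the
border edge of column `j` is the horizontal unit segment at distance `colLen j` from the top side,
so the right (bottom) edge of `(i, j)` is a border edge when `rowLen i = j + 1`
(`colLen j = i + 1`). -/
def KNDiagram.IsCorner (D : KNDiagram) (c : ℕ × ℕ) : Prop :=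
  c ∈ D.shape ∧ D.shape.rowLen c.1 = c.2 + 1 ∧ D.shape.colLen c.2 = c.1 + 1

/-- A tableau: a `(k,n)`-diagram with a (partial) filling of its cells with symbols from `α`;
`none` stands for an empty cell, and there is nothing outside of the diagram. -/
@[ext]
structure Tableau (α : Type) extends KNDiagram where
  fill : ℕ × ℕ → Option α
  fill_eq_none : ∀ c, c ∉ shape → fill c = none

/-- Permutation tableaux: `0,1`-fillings of all cells of a `(k,n)`-diagram without empty columns. -/
structure IsPermutationTableau (T : Tableau (Fin 2)) : Prop where
  no_empty_col : ∀ j < T.numCols, 0 < T.shape.colLen j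
  filled : ∀ c ∈ T.shape, T.fill c ≠ none
  exists_one : ∀ j < T.numCols, ∃ i, T.fill (i, j) = some 1
  not_zero : ∀ i j, T.fill (i, j) = some 0 →
    ¬ ((∃ i' < i, T.fill (i', j) = some 1) ∧ (∃ j' < j, T.fill (i, j') = some 1))

/-- The two symbols used in alternative tableaux. -/
inductive Arrow : Type
  | left : Arrow
  | up : Arrow

/-- Alternative tableaux: all cells to the left of a left arrow, and all cells above an up arrow,
are empty. -/
structure IsAlternativeTableau (T : Tableau Arrow) : Prop where
  left_empty : ∀ i j, T.fill (i, j) = some Arrow.left → ∀ j' < j, T.fill (i, j') = none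
  up_empty : ∀ i j, T.fill (i, j) = some Arrow.up → ∀ i' < i, T.fill (i', j) = none

/-- In a tableau with a single symbol, the cell `c` contains a point. -/
def Tableau.Pointed (T : Tableau Unit) (c : ℕ × ℕ) : Prop := T.fill c = some ()

/-- Tree-like tableaux: some cells of a `(k,n)`-diagram without empty rows or columns are pointed. -/
structure IsTreeLikeTableau (T : Tableau Unit) : Prop where
  no_empty_row : ∀ i < T.k, 0 < T.shape.rowLen i
  no_empty_col : ∀ j < T.numCols, 0 < T.shape.colLen j
  root : T.Pointed (0, 0)
  parent : ∀ i j, T.Pointed (i, j) → (i, j) ≠ (0, 0) →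
    Xor (∃ i' < i, T.Pointed (i', j)) (∃ j' < j, T.Pointed (i, j'))
  row_pointed : ∀ i < T.k, ∃ j, T.Pointed (i, j)
  col_pointed : ∀ j < T.numCols, ∃ i, T.Pointed (i, j)

/-- The number of points (all of them lie in the finite set of cells). -/
def Tableau.size (T : Tableau Unit) : ℕ :=
  (T.shape.cells.filter fun c => (T.fill c).isSome).card

/-- The set of permutation tableaux of length `n`. -/
def permutationTableaux (n : ℕ) : Set (Tableau (Fin 2)) :=
  {T | IsPermutationTableau T ∧ T.length = n}

/-- The set of alternative tableaux of length `n`. -/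
def alternativeTableaux (n : ℕ) : Set (Tableau Arrow) :=
  {T | IsAlternativeTableau T ∧ T.length = n}

/-- The set of tree-like tableaux of size `n`. -/
def treeLikeTableaux (n : ℕ) : Set (Tableau Unit) :=
  {T | IsTreeLikeTableau T ∧ T.size = n}

/-- The set of all corners of all tableaux in `X`; corners of different tableaux are different. -/
def corners {α : Type} (X : Set (Tableau α)) : Set (Tableau α × (ℕ × ℕ)) :=
  {p | p.1 ∈ X ∧ p.1.IsCorner p.2}

/-- The total number of corners of the tableaux in `X` (for a finite set of corners). -/
noncomputable def numCorners {α : Type} (X : Set (Tableau α)) : ℕ := (corners X).ncard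

end TypeATableaux

/-! Read the South-East border from North-East to South-West: a vertical step appends an empty row
at the bottom, a horizontal step attaches a full-length column on the left. Every tableau of length
n+1 thus has a unique predecessor of length n. Which columns may be attached depends only on the
free rows, those not yet forced to be blank further left. If there are r free rows, the admissible
columns together contribute (x + w)(1 + x)^r - x^(r+1) to the generating polynomial P_n(x) of the
number of free rows (`sum_validColumns`); here w = 1 if columns without marks are permitted and w =
0 otherwise. Permutation, alternative and tree-like tableaux are instances of one `ColumnRule` with
w = 0, 1, 0; a tree-like tableau is first stripped of its first column, which the rest determines.

The vertical step contributes x^(r+1), so P_(n+1)(x) = (x + w) P_n(1 + x), and P_n is a rising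
product (`sum_pow_free`). A corner arises exactly when a horizontal step follows a vertical one, so
weighting by corners gives the same recursion with an extra term (`sum_card_cornerSet_succ`), solved
in closed form by `sum_card_cornerSet`. Setting x = 1 gives the counts. Restoring the first column
of tree-like tableaux adds one corner for each stripped tableau whose last step is vertical, (n-1)!
in all. -/

namespace TypeATableaux

open Finset

/-! ### Diagrams and corners in terms of cell membership -/

namespace KNDiagram

lemma length_eq (D : KNDiagram) : D.length = D.n := by
  have := D.k_le_n
  simp only [length, numCols]
  omega

lemma row_lt (D : KNDiagram) {i j : ℕ} (h : (i, j) ∈ D.shape) : i < D.k := by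
  have h0 : (i, 0) ∈ D.shape := D.shape.up_left_mem le_rfl (Nat.zero_le j) h
  exact (YoungDiagram.mem_iff_lt_colLen.1 h0).trans_le D.colLen_le

lemma col_lt (D : KNDiagram) {i j : ℕ} (h : (i, j) ∈ D.shape) : j < D.n - D.k := by
  have h0 : (0, j) ∈ D.shape := D.shape.up_left_mem (Nat.zero_le i) le_rfl h
  exact (YoungDiagram.mem_iff_lt_rowLen.1 h0).trans_le D.rowLen_le

lemma colLen_zero_le_of_forall {μ : YoungDiagram} {k : ℕ} (h : ∀ i j, (i, j) ∈ μ → i < k) :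
    μ.colLen 0 ≤ k := by
  by_contra hk
  exact lt_irrefl k (h k 0 (YoungDiagram.mem_iff_lt_colLen.2 (not_le.1 hk)))

lemma rowLen_zero_le_of_forall {μ : YoungDiagram} {m : ℕ} (h : ∀ i j, (i, j) ∈ μ → j < m) :
    μ.rowLen 0 ≤ m := by
  by_contra hm
  exact lt_irrefl m (h 0 m (YoungDiagram.mem_iff_lt_rowLen.2 (not_le.1 hm)))

lemma isCorner_iff (D : KNDiagram) (i j : ℕ) :
    D.IsCorner (i, j) ↔ (i, j) ∈ D.shape ∧ (i, j + 1) ∉ D.shape ∧ (i + 1, j) ∉ D.shape := by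
  have h1 : (i, j) ∈ D.shape ↔ j < D.shape.rowLen i := YoungDiagram.mem_iff_lt_rowLen
  have h2 : (i, j) ∈ D.shape ↔ i < D.shape.colLen j := YoungDiagram.mem_iff_lt_colLen
  have h3 : (i, j + 1) ∈ D.shape ↔ j + 1 < D.shape.rowLen i := YoungDiagram.mem_iff_lt_rowLen
  have h4 : (i + 1, j) ∈ D.shape ↔ i + 1 < D.shape.colLen j := YoungDiagram.mem_iff_lt_colLen
  rw [h3, h4]
  simp only [IsCorner]
  constructor
  · rintro ⟨h, h5, h6⟩
    exact ⟨h, by omega, by omega⟩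
  · rintro ⟨h, h5, h6⟩
    have := h1.1 h
    have := h2.1 h
    exact ⟨h, by omega, by omega⟩

end KNDiagram

/-! ### Growing a tableau along its border -/

variable {α : Type}

/-- The diagram obtained from `μ` by attaching a new first column of length `k`. -/
def consCol (μ : YoungDiagram) (k : ℕ) (h : ∀ i j, (i, j) ∈ μ → i < k) : YoungDiagram where
  cells := (range k ×ˢ {0}) ∪ μ.cells.image fun c => (c.1, c.2 + 1)
  isLowerSet := by
    rintro ⟨i, j⟩ ⟨i', j'⟩ ⟨hi, hj⟩ hm
    simp only [coe_union, coe_product, coe_image, Set.mem_union, Set.mem_prod, mem_coe,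
      mem_range, mem_singleton, Set.mem_image, Prod.mk.injEq, Prod.exists,
      YoungDiagram.mem_cells] at hm ⊢
    simp only at hi hj
    rcases hm with ⟨h1, h2⟩ | ⟨a, b, hab, rfl, rfl⟩
    · left; omega
    · rcases j' with _ | j'
      · left; exact ⟨hi.trans_lt (h _ _ hab), rfl⟩
      · right; exact ⟨i', j', μ.up_left_mem hi (by omega) hab, rfl, rfl⟩

lemma mem_consCol_zero {μ : YoungDiagram} {k : ℕ} (h : ∀ i j, (i, j) ∈ μ → i < k) (i : ℕ) :
    (i, 0) ∈ consCol μ k h ↔ i < k := by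
  rw [← YoungDiagram.mem_cells]
  simp [consCol]

lemma mem_consCol_succ {μ : YoungDiagram} {k : ℕ} (h : ∀ i j, (i, j) ∈ μ → i < k) (i j : ℕ) :
    (i, j + 1) ∈ consCol μ k h ↔ (i, j) ∈ μ := by
  rw [← YoungDiagram.mem_cells]
  simp [consCol]

lemma shiftRight_injective : Function.Injective fun p : ℕ × ℕ => (p.1, p.2 + 1) := by
  rintro ⟨a, b⟩ ⟨a', b'⟩ h
  simpa using h

/-- The diagram obtained from `μ` by deleting the first column. -/
noncomputable def tailCol (μ : YoungDiagram) : YoungDiagram where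
  cells := μ.cells.preimage (fun p => (p.1, p.2 + 1)) shiftRight_injective.injOn
  isLowerSet := by
    rintro ⟨i, j⟩ ⟨i', j'⟩ ⟨hi, hj⟩ hm
    have hm' : (i, j + 1) ∈ μ :=
      (Finset.mem_preimage (hf := shiftRight_injective.injOn)).1 (mem_coe.1 hm)
    exact mem_coe.2 ((Finset.mem_preimage (hf := shiftRight_injective.injOn)).2
      (μ.up_left_mem hi (Nat.succ_le_succ hj) hm'))

lemma mem_tailCol {μ : YoungDiagram} (i j : ℕ) : (i, j) ∈ tailCol μ ↔ (i, j + 1) ∈ μ :=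
  Finset.mem_preimage (hf := shiftRight_injective.injOn)

lemma youngDiagram_ext {μ ν : YoungDiagram} (h : ∀ i j, (i, j) ∈ μ ↔ (i, j) ∈ ν) : μ = ν := by
  ext ⟨i, j⟩
  simpa using h i j

namespace Tableau

/-- Adding an empty row at the bottom. -/
def addRow (T : Tableau α) : Tableau α where
  k := T.k + 1
  n := T.n + 1
  k_le_n := Nat.succ_le_succ T.k_le_n
  shape := T.shape
  colLen_le := T.colLen_le.trans (Nat.le_succ _)
  rowLen_le := by simpa using T.rowLen_le
  fill := T.fill
  fill_eq_none := T.fill_eq_none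

/-- Adding a first column of maximal length, with filling `c`. -/
def addCol (T : Tableau α) (c : ℕ → Option α) : Tableau α where
  k := T.k
  n := T.n + 1
  k_le_n := T.k_le_n.trans (Nat.le_succ _)
  shape := consCol T.shape T.k fun _ _ => T.row_lt
  colLen_le := KNDiagram.colLen_zero_le_of_forall fun i j h => by
    rcases j with _ | j
    · exact (mem_consCol_zero _ i).1 h
    · exact T.row_lt ((mem_consCol_succ _ i j).1 h)
  rowLen_le := KNDiagram.rowLen_zero_le_of_forall fun i j h => by
    have := T.k_le_n
    rcases j with _ | j
    · omega
    · have := T.col_lt ((mem_consCol_succ _ i j).1 h)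
      omega
  fill := fun p => match p with
    | (i, 0) => if i < T.k then c i else none
    | (i, j + 1) => T.fill (i, j)
  fill_eq_none := by
    rintro ⟨i, _ | j⟩ h
    · have : ¬ i < T.k := fun hi => h ((mem_consCol_zero _ i).2 hi)
      simp [this]
    · exact T.fill_eq_none _ fun hi => h ((mem_consCol_succ _ i j).2 hi)

/-- Deleting the first column. -/
noncomputable def delCol (T : Tableau α) : Tableau α where
  k := T.k
  -- The maximum matters only if there is no column to delete; it keeps `k ≤ n`.
  n := max T.k (T.n - 1)
  k_le_n := le_max_left _ _
  shape := tailCol T.shape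
  colLen_le := KNDiagram.colLen_zero_le_of_forall fun i j h => T.row_lt ((mem_tailCol i j).1 h)
  rowLen_le := KNDiagram.rowLen_zero_le_of_forall fun i j h => by
    have := T.col_lt ((mem_tailCol i j).1 h)
    omega
  fill := fun p => T.fill (p.1, p.2 + 1)
  fill_eq_none := fun p h => T.fill_eq_none _ fun hp => h ((mem_tailCol p.1 p.2).2 hp)

@[simp] lemma addRow_k (T : Tableau α) : T.addRow.k = T.k + 1 := rfl
@[simp] lemma addRow_n (T : Tableau α) : T.addRow.n = T.n + 1 := rfl
@[simp] lemma addRow_shape (T : Tableau α) : T.addRow.shape = T.shape := rfl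
@[simp] lemma addRow_fill (T : Tableau α) : T.addRow.fill = T.fill := rfl
@[simp] lemma addCol_k (T : Tableau α) (c) : (T.addCol c).k = T.k := rfl
@[simp] lemma addCol_n (T : Tableau α) (c) : (T.addCol c).n = T.n + 1 := rfl

@[simp] lemma mem_addCol_zero (T : Tableau α) (c) (i : ℕ) :
    (i, 0) ∈ (T.addCol c).shape ↔ i < T.k :=
  mem_consCol_zero (fun _ _ => T.row_lt) i

@[simp] lemma mem_addCol_succ (T : Tableau α) (c) (i j : ℕ) :
    (i, j + 1) ∈ (T.addCol c).shape ↔ (i, j) ∈ T.shape :=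
  mem_consCol_succ (fun _ _ => T.row_lt) i j

lemma addCol_fill_zero (T : Tableau α) (c) (i : ℕ) :
    (T.addCol c).fill (i, 0) = if i < T.k then c i else none := rfl

@[simp] lemma addCol_fill_succ (T : Tableau α) (c) (i j : ℕ) :
    (T.addCol c).fill (i, j + 1) = T.fill (i, j) := rfl

@[simp] lemma addRow_numCols (T : Tableau α) : T.addRow.numCols = T.numCols := by
  simp [KNDiagram.numCols]

@[simp] lemma addCol_numCols (T : Tableau α) (c) : (T.addCol c).numCols = T.numCols + 1 := by
  have := T.k_le_n
  simp only [KNDiagram.numCols, addCol_k, addCol_n]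
  omega

@[simp] lemma addRow_length (T : Tableau α) : T.addRow.length = T.length + 1 := by
  simp [KNDiagram.length_eq]

@[simp] lemma addCol_length (T : Tableau α) (c) : (T.addCol c).length = T.length + 1 := by
  simp [KNDiagram.length_eq]

lemma addRow_injective : Function.Injective (addRow : Tableau α → Tableau α) := by
  intro T U h
  have hk : T.k + 1 = U.k + 1 := congrArg (fun V : Tableau α => V.k) h
  have hn : T.n + 1 = U.n + 1 := congrArg (fun V : Tableau α => V.n) h
  have hs : T.addRow.shape = U.addRow.shape := congrArg (fun V : Tableau α => V.shape) h
  have hf : T.addRow.fill = U.addRow.fill := congrArg (fun V : Tableau α => V.fill) h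
  exact Tableau.ext (by omega) (by omega) hs hf

lemma delCol_addCol (T : Tableau α) (c : ℕ → Option α) : (T.addCol c).delCol = T := by
  have := T.k_le_n
  refine Tableau.ext rfl ?_ ?_ rfl
  · simp only [delCol, addCol_k, addCol_n]
    omega
  · refine youngDiagram_ext fun i j => ?_
    simp [delCol, mem_tailCol]

/-- `addCol` discards the entries from row `k` on, so they have to be normalised. -/
lemma addCol_injOn (T : Tableau α) :
    Set.InjOn T.addCol {c | ∀ i, T.k ≤ i → c i = none} := by
  intro c hc d hd h
  funext i
  rcases lt_or_ge i T.k with hi | hi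
  · have := congrArg (fun V : Tableau α => V.fill (i, 0)) h
    simpa [addCol_fill_zero, hi] using this
  · rw [hc i hi, hd i hi]

lemma addRow_ne_addCol (T U : Tableau α) (c : ℕ → Option α) : T.addRow ≠ U.addCol c := by
  intro h
  have hk : T.k + 1 = U.k := congrArg (fun V : Tableau α => V.k) h
  have hs : (T.k, 0) ∈ (U.addCol c).shape := (mem_addCol_zero _ _ _).2 (by omega)
  rw [← h] at hs
  exact lt_irrefl _ (T.row_lt hs)

/-- The last step of the South-East border is vertical. -/
def EndsWithRow (T : Tableau α) : Prop := 0 < T.k ∧ (T.k - 1, 0) ∉ T.shape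

lemma addRow_endsWithRow (T : Tableau α) : T.addRow.EndsWithRow :=
  ⟨Nat.succ_pos _, fun h => lt_irrefl _ (T.row_lt h)⟩

lemma not_addCol_endsWithRow (T : Tableau α) (c : ℕ → Option α) :
    ¬ (T.addCol c).EndsWithRow := by
  rintro ⟨h, h'⟩
  simp only [addCol_k, mem_addCol_zero] at h h'
  omega

lemma exists_addRow_eq (T : Tableau α) (h : T.EndsWithRow) : ∃ U : Tableau α, U.addRow = T := by
  obtain ⟨h0, h1⟩ := h
  have hn := T.k_le_n
  refine ⟨{ k := T.k - 1, n := T.n - 1, k_le_n := by omega, shape := T.shape,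
            colLen_le := ?_, rowLen_le := ?_, fill := T.fill,
            fill_eq_none := T.fill_eq_none }, ?_⟩
  · by_contra hc
    exact h1 (YoungDiagram.mem_iff_lt_colLen.2 (not_le.1 hc))
  · have := T.rowLen_le
    omega
  · refine Tableau.ext ?_ ?_ rfl rfl <;> simp only [addRow_k, addRow_n] <;> omega

/-- If the bottom row is not empty, no row is, so the first column has full length. Positive length
provides a column even when there are no rows. -/
lemma exists_addCol_eq (T : Tableau α) (h : ¬ T.EndsWithRow) (hn : 0 < T.length) :
    T.delCol.addCol (fun i => T.fill (i, 0)) = T := by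
  have hk := T.k_le_n
  rw [KNDiagram.length_eq] at hn
  have hfull : ∀ i, i < T.k → (i, 0) ∈ T.shape := fun i hi => by
    by_contra hc
    exact h ⟨by omega, fun hm => hc (T.shape.up_left_mem (by omega) le_rfl hm)⟩
  have hlt : T.k < T.n := by
    rcases Nat.eq_zero_or_pos T.k with h0 | h0
    · omega
    · have := T.col_lt (hfull 0 h0)
      omega
  refine Tableau.ext rfl ?_ ?_ ?_
  · simp only [addCol_n, delCol]
    omega
  · refine youngDiagram_ext fun i j => ?_
    rcases j with _ | j
    · rw [mem_addCol_zero]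
      exact ⟨hfull i, fun hm => T.row_lt hm⟩
    · rw [mem_addCol_succ]
      exact mem_tailCol i j
  · funext ⟨i, j⟩
    rcases j with _ | j
    · rw [addCol_fill_zero]
      split_ifs with hi
      · rfl
      · exact (T.fill_eq_none _ fun hm => hi (T.row_lt hm)).symm
    · rfl

/-- The tableau of length `0`. -/
def empty : Tableau α where
  k := 0
  n := 0
  k_le_n := le_rfl
  shape := ⊥
  colLen_le := KNDiagram.colLen_zero_le_of_forall fun i j h => absurd h (by simp)
  rowLen_le := KNDiagram.rowLen_zero_le_of_forall fun i j h => absurd h (by simp)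
  fill := fun _ => none
  fill_eq_none := fun _ _ => rfl

lemma eq_empty_of_length_eq_zero (T : Tableau α) (h : T.length = 0) : T = empty := by
  rw [KNDiagram.length_eq] at h
  have hk : T.k = 0 := by have := T.k_le_n; omega
  have hs : ∀ i j, (i, j) ∉ T.shape := fun i j hm => by have := T.row_lt hm; omega
  refine Tableau.ext hk h (youngDiagram_ext fun i j => ?_) ?_
  · simp [hs i j, empty]
  · funext ⟨i, j⟩
    exact T.fill_eq_none _ (hs i j)

/-! ### Effect of a border step on the corners -/

open Classical in
/-- The finite set of corners. -/
noncomputable def cornerSet (T : Tableau α) : Finset (ℕ × ℕ) :=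
  T.shape.cells.filter fun c => T.IsCorner c

lemma mem_cornerSet (T : Tableau α) (c : ℕ × ℕ) : c ∈ T.cornerSet ↔ T.IsCorner c := by
  simp only [cornerSet, mem_filter, YoungDiagram.mem_cells, and_iff_right_iff_imp]
  exact fun h => h.1

lemma card_cornerSet_addRow (T : Tableau α) : #T.addRow.cornerSet = #T.cornerSet := by
  congr 1

open Classical in
-- Old corners move one column to the right. In the new column only the bottom cell has nothing
-- below it, and it is a corner precisely when its row was empty before.
lemma card_cornerSet_addCol (T : Tableau α) (c : ℕ → Option α) :
    #(T.addCol c).cornerSet = #T.cornerSet + if T.EndsWithRow then 1 else 0 := by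
  have hinj := shiftRight_injective
  have key : (T.addCol c).cornerSet = T.cornerSet.image (fun p => (p.1, p.2 + 1)) ∪
      if T.EndsWithRow then {(T.k - 1, 0)} else ∅ := by
    ext ⟨i, j⟩
    rw [mem_cornerSet, KNDiagram.isCorner_iff, mem_union, mem_image]
    rcases j with _ | j
    · have h1 : ¬ ∃ a ∈ T.cornerSet, (a.1, a.2 + 1) = (i, 0) := by simp
      rw [mem_addCol_zero, mem_addCol_zero, mem_addCol_succ, or_iff_right h1]
      split_ifs with h
      · simp only [mem_singleton, Prod.mk.injEq, and_true]
        constructor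
        · omega
        · rintro rfl
          have := h.1
          exact ⟨by omega, h.2, by omega⟩
      · simp only [notMem_empty, iff_false]
        rintro ⟨h2, h3, h4⟩
        have : i = T.k - 1 := by omega
        subst this
        exact h ⟨by omega, h3⟩
    · have h1 : (i, j + 1) ∉ (if T.EndsWithRow then {(T.k - 1, 0)} else ∅ : Finset (ℕ × ℕ)) := by
        split_ifs <;> simp
      rw [mem_addCol_succ, mem_addCol_succ, mem_addCol_succ, or_iff_left h1,
        ← KNDiagram.isCorner_iff, ← mem_cornerSet]
      constructor
      · exact fun h => ⟨(i, j), h, rfl⟩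
      · rintro ⟨p, hp, he⟩
        have : p = (i, j) := hinj he
        rwa [← this]
  rw [key, card_union_of_disjoint, card_image_of_injective _ hinj]
  · split_ifs <;> simp
  · rw [Finset.disjoint_left]
    intro p hp hq
    obtain ⟨a, -, rfl⟩ := mem_image.1 hp
    split_ifs at hq <;> simp at hq

end Tableau

/-- A local rule for fillings. A symbol is a mark if it differs from `blank`; `allowed s a` says that
the symbol `a` may be used in a cell which has (`s = true`) or has not (`s = false`) a mark above it,
and `kills s a` says that then all cells to its left have to be blank. If `needsMark` holds, every
column has to contain a mark. -/
structure ColumnRule (α : Type) where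
  blank : Option α
  allowed : Bool → Option α → Bool
  kills : Bool → Option α → Bool
  needsMark : Bool

/-! ### Column rules and the weight of one cell -/

namespace ColumnRule

/-- The contribution of a column without marks. -/
def weight (R : ColumnRule α) : ℚ := if R.needsMark then 0 else 1

/-- The transfer rule of a free cell, where `x` marks rows which stay free. -/
structure Balanced [Fintype α] [DecidableEq α] (R : ColumnRule α) : Prop where
  blank_allowed : ∀ s, R.allowed s R.blank = true
  -- `u` and `v` are the values of a column with and without a mark. The first mark may leave its
  -- row free (`x`) or kill it (1, possible only for left arrows); that the latter option has the
  -- same weight as a column without marks is what makes the final formula uniform.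
  sum_false : ∀ x u v : ℚ, ∑ a with R.allowed false a = true,
    (if R.kills false a = true then 1 else x) * (if a = R.blank then v else u) =
      x * v + (x + R.weight) * u
  sum_true : ∀ x : ℚ, ∑ a with R.allowed true a = true,
    (if R.kills true a = true then 1 else x) = 1 + x

/-! ### Enumeration of one column -/

section Columns

variable [DecidableEq α] (R : ColumnRule α)

/-- Whether the column `c` has a mark above row `i`. -/
def seen (c : ℕ → Option α) (i : ℕ) : Bool := decide (∃ i' < i, c i' ≠ R.blank)

lemma seen_eq_true {c : ℕ → Option α} {i : ℕ} :
    R.seen c i = true ↔ ∃ i' < i, c i' ≠ R.blank := by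
  simp [seen]

lemma seen_congr {c d : ℕ → Option α} {i : ℕ} (h : ∀ i' < i, c i' = d i') :
    R.seen c i = R.seen d i := by
  rw [Bool.eq_iff_iff, seen_eq_true, seen_eq_true]
  constructor
  · rintro ⟨i', hi, h'⟩
    exact ⟨i', hi, h i' hi ▸ h'⟩
  · rintro ⟨i', hi, h'⟩
    exact ⟨i', hi, (h i' hi).symm ▸ h'⟩

lemma seen_zero (c : ℕ → Option α) : R.seen c 0 = false := by
  simp [seen]

lemma seen_succ (c : ℕ → Option α) (i : ℕ) :
    R.seen c (i + 1) = (R.seen c i || decide (c i ≠ R.blank)) := by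
  rw [Bool.eq_iff_iff, Bool.or_eq_true, seen_eq_true, seen_eq_true, decide_eq_true_eq]
  constructor
  · rintro ⟨i', hi, h⟩
    rcases Nat.lt_succ_iff_lt_or_eq.1 hi with hi | rfl
    · exact Or.inl ⟨i', hi, h⟩
    · exact Or.inr h
  · rintro (⟨i', hi, h⟩ | h)
    · exact ⟨i', by omega, h⟩
    · exact ⟨i, by omega, h⟩

lemma seen_update (c : ℕ → Option α) (k : ℕ) (a : Option α) {i : ℕ} (hi : i ≤ k) :
    R.seen (Function.update c k a) i = R.seen c i :=
  R.seen_congr fun i' h => Function.update_of_ne (by omega) _ _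

/-- The rows above row `k` which are still free after adding the column `c`. -/
def remaining (F : Finset ℕ) (c : ℕ → Option α) (k : ℕ) : Finset ℕ :=
  (range k).filter fun i => i ∈ F ∧ R.kills (R.seen c i) (c i) = false

lemma card_remaining_update (F : Finset ℕ) (c : ℕ → Option α) (k : ℕ) (a : Option α) :
    #(R.remaining F (Function.update c k a) (k + 1)) =
      #(R.remaining F c k) + if k ∈ F ∧ R.kills (R.seen c k) a = false then 1 else 0 := by
  have h : (range k).filter (fun i => i ∈ F ∧ R.kills (R.seen (Function.update c k a) i)
      (Function.update c k a i) = false) = R.remaining F c k := by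
    refine filter_congr fun i hi => ?_
    have hi := mem_range.1 hi
    rw [R.seen_update c k a hi.le, Function.update_of_ne hi.ne]
  rw [remaining, range_add_one, filter_insert, h, R.seen_update c k a le_rfl, Function.update_self]
  split_ifs
  · rw [card_insert_of_notMem]
    simp [remaining]
  · rfl

variable [Fintype α]

/-- The symbols which may be put in row `i` of a new column, if `F` is the set of free rows. -/
def choices (F : Finset ℕ) (i : ℕ) (s : Bool) : Finset (Option α) :=
  if i ∈ F then univ.filter fun a => R.allowed s a = true else {R.blank}

open Classical in
/-- The columns of length `k` which may be added, if `F` is the set of free rows. -/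
noncomputable def columns (F : Finset ℕ) : ℕ → Finset (ℕ → Option α)
  | 0 => {fun _ => none}
  | k + 1 => (columns F k).biUnion fun c =>
      (R.choices F k (R.seen c k)).image fun a => Function.update c k a

lemma mem_columns {F : Finset ℕ} {k : ℕ} {c : ℕ → Option α} : c ∈ R.columns F k ↔
    (∀ i, k ≤ i → c i = none) ∧ ∀ i < k, c i ∈ R.choices F i (R.seen c i) := by
  classical
  induction k generalizing c with
  | zero =>
    simp only [columns, mem_singleton, Nat.zero_le, true_implies, Nat.not_lt_zero,
      false_implies, implies_true, and_true]
    exact funext_iff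
  | succ k ih =>
    simp only [columns, mem_biUnion, mem_image]
    constructor
    · rintro ⟨d, hd, a, ha, rfl⟩
      obtain ⟨h1, h2⟩ := ih.1 hd
      refine ⟨fun i hi => ?_, fun i hi => ?_⟩
      · rw [Function.update_of_ne (by omega)]
        exact h1 i (by omega)
      · rw [R.seen_update d k a (by omega)]
        rcases Nat.lt_succ_iff_lt_or_eq.1 hi with hi | rfl
        · rw [Function.update_of_ne (by omega)]
          exact h2 i hi
        · rwa [Function.update_self]
    · rintro ⟨h1, h2⟩
      -- Columns of length `k` are `none` from row `k` on, so the truncation of `c` is the only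
      -- possible predecessor.
      refine ⟨Function.update c k none, ih.2 ⟨fun i hi => ?_, fun i hi => ?_⟩, c k, ?_, ?_⟩
      · rcases Nat.eq_or_lt_of_le hi with rfl | hi
        · rw [Function.update_self]
        · rw [Function.update_of_ne (by omega)]
          exact h1 i hi
      · rw [R.seen_update c k _ hi.le, Function.update_of_ne (by omega)]
        exact h2 i (by omega)
      · rw [R.seen_update c k _ le_rfl]
        exact h2 k (by omega)
      · rw [Function.update_idem, Function.update_eq_self]

lemma sum_columns_succ {M : Type*} [AddCommMonoid M] (F : Finset ℕ) (k : ℕ)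
    (f : (ℕ → Option α) → M) :
    ∑ c ∈ R.columns F (k + 1), f c =
      ∑ c ∈ R.columns F k, ∑ a ∈ R.choices F k (R.seen c k), f (Function.update c k a) := by
  classical
  rw [columns, sum_biUnion]
  · refine sum_congr rfl fun c _ => sum_image fun a _ b _ h => ?_
    simpa using congrFun h k
  · intro c hc d hd hcd
    rw [Function.onFun, Finset.disjoint_left]
    intro e h1 h2
    obtain ⟨a, -, rfl⟩ := mem_image.1 h1
    obtain ⟨b, -, h⟩ := mem_image.1 h2
    refine hcd ?_
    have hc := (R.mem_columns.1 (mem_coe.1 hc)).1 k le_rfl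
    have hd := (R.mem_columns.1 (mem_coe.1 hd)).1 k le_rfl
    funext i
    rcases eq_or_ne i k with rfl | hi
    · rw [hc, hd]
    · simpa [hi] using (congrFun h i).symm

/-- Summing over the last cell, if its row is free, replaces the pair (u, v) by ((1 + x)u, xv + (x +
w)u); hence the induction on `k` with `u` and `v` general. A row that is not free changes nothing.
-/
lemma sum_columns {R : ColumnRule α} (hR : R.Balanced) (F : Finset ℕ) (k : ℕ) (x u v : ℚ) :
    ∑ c ∈ R.columns F k, x ^ #(R.remaining F c k) * (if R.seen c k = true then u else v) =
      x ^ #((range k).filter (· ∈ F)) * v +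
        (x + R.weight) * ((1 + x) ^ #((range k).filter (· ∈ F)) -
          x ^ #((range k).filter (· ∈ F))) * u := by
  induction k generalizing u v with
  | zero => simp [columns, remaining, seen_zero]
  | succ k ih =>
    rw [sum_columns_succ]
    by_cases hk : k ∈ F
    · have hcard : #((range (k + 1)).filter (· ∈ F)) = #((range k).filter (· ∈ F)) + 1 := by
        rw [range_add_one, filter_insert, if_pos hk, card_insert_of_notMem (by simp)]
      have key : ∀ c ∈ R.columns F k, ∑ a ∈ R.choices F k (R.seen c k),
          x ^ #(R.remaining F (Function.update c k a) (k + 1)) *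
            (if R.seen (Function.update c k a) (k + 1) = true then u else v) =
          x ^ #(R.remaining F c k) *
            (if R.seen c k = true then (1 + x) * u else x * v + (x + R.weight) * u) := by
        intro c _
        simp only [card_remaining_update, seen_succ, R.seen_update c k _ le_rfl,
          Function.update_self, choices, hk, ↓reduceIte, true_and, pow_add, mul_assoc]
        rw [← mul_sum]
        congr 1
        rcases hs : R.seen c k with _ | _
        · rw [if_neg (show ¬ (false = true) by simp), ← hR.sum_false x u v]
          refine sum_congr rfl fun a _ => ?_
          by_cases ha : a = R.blank <;> cases h : R.kills false a <;> simp [ha]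
        · rw [if_pos rfl, ← hR.sum_true x, sum_mul]
          refine sum_congr rfl fun a _ => ?_
          cases h : R.kills true a <;> simp
      rw [sum_congr rfl key, ih, hcard]
      ring
    · have hcard : (range (k + 1)).filter (· ∈ F) = (range k).filter (· ∈ F) := by
        rw [range_add_one, filter_insert, if_neg hk]
      rw [hcard, ← ih u v]
      refine sum_congr rfl fun c _ => ?_
      simp [choices, hk, card_remaining_update, seen_succ, R.seen_update c k _ le_rfl]

end Columns

/-! ### Tableaux obeying a rule, and their generating polynomials -/

section Tableaux

variable [DecidableEq α] (R : ColumnRule α)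

/-- The tableaux which obey the rule `R`. -/
structure Good (T : Tableau α) : Prop where
  allowed : ∀ i j, (i, j) ∈ T.shape →
    R.allowed (R.seen (fun i' => T.fill (i', j)) i) (T.fill (i, j)) = true
  killed : ∀ i j, (i, j) ∈ T.shape →
    R.kills (R.seen (fun i' => T.fill (i', j)) i) (T.fill (i, j)) = true →
      ∀ j' < j, T.fill (i, j') = R.blank
  mark : R.needsMark = true → ∀ j < T.numCols, ∃ i, (i, j) ∈ T.shape ∧ T.fill (i, j) ≠ R.blank

open Classical in
/-- The rows in which a new first column may have a mark. -/
noncomputable def free (T : Tableau α) : Finset ℕ :=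
  (range T.k).filter fun i => ∀ j, (i, j) ∈ T.shape →
    R.kills (R.seen (fun i' => T.fill (i', j)) i) (T.fill (i, j)) = false

lemma mem_free {T : Tableau α} {i : ℕ} : i ∈ R.free T ↔ i < T.k ∧ ∀ j, (i, j) ∈ T.shape →
    R.kills (R.seen (fun i' => T.fill (i', j)) i) (T.fill (i, j)) = false := by
  simp [free]

lemma free_addRow (T : Tableau α) : R.free T.addRow = insert T.k (R.free T) := by
  ext i
  simp only [mem_free, mem_insert, Tableau.addRow_k, Tableau.addRow_shape, Tableau.addRow_fill]
  constructor
  · rintro ⟨h1, h2⟩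
    rcases Nat.lt_succ_iff_lt_or_eq.1 h1 with h | h
    · exact Or.inr ⟨h, h2⟩
    · exact Or.inl h
  · rintro (rfl | ⟨h1, h2⟩)
    · exact ⟨Nat.lt_succ_self _, fun j hj => absurd (T.row_lt hj) (lt_irrefl _)⟩
    · exact ⟨by omega, h2⟩

lemma card_free_addRow (T : Tableau α) : #(R.free T.addRow) = #(R.free T) + 1 := by
  rw [free_addRow, card_insert_of_notMem]
  simp [mem_free]

lemma seen_addCol_zero (T : Tableau α) (c : ℕ → Option α) {i : ℕ} (hi : i ≤ T.k) :
    R.seen (fun i' => (T.addCol c).fill (i', 0)) i = R.seen c i :=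
  R.seen_congr fun i' h => by rw [Tableau.addCol_fill_zero, if_pos (by omega)]

lemma free_addCol (T : Tableau α) (c : ℕ → Option α) :
    R.free (T.addCol c) = R.remaining (R.free T) c T.k := by
  ext i
  simp only [remaining, mem_filter, mem_range, mem_free, Tableau.addCol_k]
  constructor
  · rintro ⟨h1, h2⟩
    refine ⟨h1, ⟨h1, fun j hj => ?_⟩, ?_⟩
    · simpa using h2 (j + 1) (by simpa using hj)
    · have := h2 0 (by simpa using h1)
      rwa [R.seen_addCol_zero T c h1.le, Tableau.addCol_fill_zero, if_pos h1] at this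
  · rintro ⟨h1, ⟨-, h2⟩, h3⟩
    refine ⟨h1, fun j hj => ?_⟩
    rcases j with _ | j
    · rwa [R.seen_addCol_zero T c h1.le, Tableau.addCol_fill_zero, if_pos h1]
    · simpa using h2 j (by simpa using hj)

lemma good_addRow (T : Tableau α) : R.Good T.addRow ↔ R.Good T := by
  constructor
  · rintro ⟨h1, h2, h3⟩
    exact ⟨h1, h2, by simpa using h3⟩
  · rintro ⟨h1, h2, h3⟩
    exact ⟨h1, h2, by simpa using h3⟩

lemma good_empty : R.Good Tableau.empty where
  allowed i j h := absurd h (by simp [Tableau.empty])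
  killed i j h := absurd h (by simp [Tableau.empty])
  mark _ j h := absurd h (by simp [Tableau.empty, KNDiagram.numCols])

variable [Fintype α]

/-- The columns which may be added to `T`. -/
noncomputable def validColumns (T : Tableau α) : Finset (ℕ → Option α) :=
  (R.columns (R.free T) T.k).filter fun c => R.needsMark = true → R.seen c T.k = true

/-- The old columns restrict the new one only through the rows they kill, and these are exactly the
rows that are not free. There the blank is forced, which `blank_allowed` makes legal. -/
lemma good_addCol {R : ColumnRule α} (hR : R.Balanced) (T : Tableau α) (c : ℕ → Option α)
    (hc : ∀ i, T.k ≤ i → c i = none) :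
    R.Good (T.addCol c) ↔ R.Good T ∧ c ∈ R.validColumns T := by
  simp only [validColumns, mem_filter, mem_columns]
  constructor
  · rintro ⟨h1, h2, h3⟩
    refine ⟨⟨fun i j hj => ?_, fun i j hj hk j' hj' => ?_, fun hm j hj => ?_⟩,
      ⟨hc, fun i hi => ?_⟩, fun hm => ?_⟩
    · simpa using h1 i (j + 1) (by simpa using hj)
    · simpa using h2 i (j + 1) (by simpa using hj) (by simpa using hk) (j' + 1) (by omega)
    · simpa using h3 hm (j + 1) (by simpa using hj)
    · simp only [choices]
      split_ifs with hF
      · have := h1 i 0 (by simpa using hi)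
        rw [R.seen_addCol_zero T c hi.le, Tableau.addCol_fill_zero, if_pos hi] at this
        simpa using this
      · simp only [mem_free, not_and, not_forall, Bool.not_eq_false] at hF
        obtain ⟨j, hj, hk⟩ := hF hi
        have := h2 i (j + 1) (by simpa using hj) (by simpa using hk) 0 (Nat.succ_pos _)
        rw [Tableau.addCol_fill_zero, if_pos hi] at this
        simpa using this
    · obtain ⟨i, hi, h⟩ := h3 hm 0 (by simp)
      rw [Tableau.mem_addCol_zero] at hi
      rw [Tableau.addCol_fill_zero, if_pos hi] at h
      exact R.seen_eq_true.2 ⟨i, hi, h⟩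
  · rintro ⟨⟨h1, h2, h3⟩, ⟨-, h4⟩, h5⟩
    refine ⟨fun i j hj => ?_, fun i j hj hk j' hj' => ?_, fun hm j hj => ?_⟩
    · rcases j with _ | j
      · rw [Tableau.mem_addCol_zero] at hj
        rw [R.seen_addCol_zero T c hj.le, Tableau.addCol_fill_zero, if_pos hj]
        have := h4 i hj
        simp only [choices] at this
        split_ifs at this with hF
        · simpa using this
        · rw [mem_singleton.1 this]
          exact hR.blank_allowed _
      · simpa using h1 i j (by simpa using hj)
    · rcases j with _ | j
      · omega
      rw [Tableau.mem_addCol_succ] at hj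
      rw [Tableau.addCol_fill_succ] at hk
      rcases j' with _ | j'
      · have hi := T.row_lt hj
        have hF : i ∉ R.free T := fun hF => by
          have := (R.mem_free.1 hF).2 j hj
          simp only [Tableau.addCol_fill_succ] at hk
          rw [this] at hk
          exact absurd hk (by simp)
        have := h4 i hi
        rw [choices, if_neg hF, mem_singleton] at this
        rw [Tableau.addCol_fill_zero, if_pos hi, this]
      · simpa using h2 i j hj (by simpa using hk) j' (by omega)
    · rcases j with _ | j
      · obtain ⟨i, hi, h⟩ := R.seen_eq_true.1 (h5 hm)
        refine ⟨i, by simpa using hi, ?_⟩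
        rwa [Tableau.addCol_fill_zero, if_pos hi]
      · simpa using h3 hm j (by simpa using hj)

/-- This is `sum_columns` with `u = 1` and `v = R.weight`: a column without marks counts only if
marks are not required. -/
lemma sum_validColumns {R : ColumnRule α} (hR : R.Balanced) (T : Tableau α) (x : ℚ) :
    ∑ c ∈ R.validColumns T, x ^ #(R.free (T.addCol c)) =
      (x + R.weight) * (1 + x) ^ #(R.free T) - x * x ^ #(R.free T) := by
  have h := sum_columns hR (R.free T) T.k x 1 R.weight
  have hF : (range T.k).filter (· ∈ R.free T) = R.free T := by
    ext i
    simp only [mem_filter, mem_range, mem_free]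
    tauto
  rw [hF] at h
  rw [validColumns, sum_filter]
  refine Eq.trans ?_ (h.trans (by ring))
  refine sum_congr rfl fun c _ => ?_
  rw [free_addCol, weight]
  by_cases h1 : R.needsMark = true <;> by_cases h2 : R.seen c T.k = true <;> simp [h1, h2]

open Classical in
/-- The tableaux of length `n` which obey the rule `R`, constructed along the border. -/
noncomputable def goodTableaux : ℕ → Finset (Tableau α)
  | 0 => {Tableau.empty}
  | n + 1 => (goodTableaux n).image Tableau.addRow ∪
      (goodTableaux n).biUnion fun T => (R.validColumns T).image T.addCol

lemma eq_none_of_mem_validColumns {T : Tableau α} {c : ℕ → Option α}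
    (hc : c ∈ R.validColumns T) : ∀ i, T.k ≤ i → c i = none :=
  (R.mem_columns.1 (mem_filter.1 hc).1).1

lemma mem_goodTableaux {R : ColumnRule α} (hR : R.Balanced) {n : ℕ} {T : Tableau α} :
    T ∈ R.goodTableaux n ↔ R.Good T ∧ T.length = n := by
  induction n generalizing T with
  | zero =>
    rw [goodTableaux, mem_singleton]
    constructor
    · rintro rfl
      exact ⟨R.good_empty, rfl⟩
    · exact fun h => T.eq_empty_of_length_eq_zero h.2
  | succ n ih =>
    simp only [goodTableaux, mem_union, mem_image, mem_biUnion]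
    constructor
    · rintro (⟨U, hU, rfl⟩ | ⟨U, hU, c, hc, rfl⟩)
      · obtain ⟨h1, h2⟩ := ih.1 hU
        exact ⟨(R.good_addRow U).2 h1, by simp [h2]⟩
      · obtain ⟨h1, h2⟩ := ih.1 hU
        exact ⟨(good_addCol hR U c (R.eq_none_of_mem_validColumns hc)).2 ⟨h1, hc⟩, by simp [h2]⟩
    · rintro ⟨h1, h2⟩
      by_cases hE : T.EndsWithRow
      · obtain ⟨U, rfl⟩ := T.exists_addRow_eq hE
        rw [Tableau.addRow_length] at h2
        exact Or.inl ⟨U, ih.2 ⟨(R.good_addRow U).1 h1, by omega⟩, rfl⟩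
      · have h := T.exists_addCol_eq hE (by omega)
        rw [← h, Tableau.addCol_length] at h2
        rw [← h, good_addCol hR] at h1
        · exact Or.inr ⟨T.delCol, ih.2 ⟨h1.1, by omega⟩, _, h1.2, h⟩
        · exact fun i hi => T.fill_eq_none _ fun hm => absurd (T.row_lt hm) (not_lt.2 hi)

/-- No tableau is produced twice: `EndsWithRow` separates the two kinds of step, `delCol` recovers
the predecessor, and the first column recovers `c`. -/
lemma sum_goodTableaux_succ {M : Type*} [AddCommMonoid M] (n : ℕ) (f : Tableau α → M) :
    ∑ T ∈ R.goodTableaux (n + 1), f T =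
      ∑ T ∈ R.goodTableaux n, (f T.addRow + ∑ c ∈ R.validColumns T, f (T.addCol c)) := by
  classical
  rw [goodTableaux, sum_union, sum_image fun _ _ _ _ h => Tableau.addRow_injective h,
    sum_biUnion, sum_add_distrib]
  · congr 1
    refine sum_congr rfl fun T _ => sum_image fun c hc d hd h => ?_
    exact T.addCol_injOn (R.eq_none_of_mem_validColumns hc) (R.eq_none_of_mem_validColumns hd) h
  · intro T _ U _ hTU
    rw [Function.onFun, Finset.disjoint_left]
    intro V h1 h2
    obtain ⟨c, -, rfl⟩ := mem_image.1 h1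
    obtain ⟨d, -, h⟩ := mem_image.1 h2
    exact hTU (by rw [← T.delCol_addCol c, ← h, U.delCol_addCol d])
  · rw [Finset.disjoint_left]
    intro V h1 h2
    obtain ⟨T, -, rfl⟩ := mem_image.1 h1
    obtain ⟨U, -, h2⟩ := mem_biUnion.1 h2
    obtain ⟨c, -, h⟩ := mem_image.1 h2
    exact T.addRow_ne_addCol U c h.symm

/-- The term of the vertical step cancels the negative term of `sum_validColumns`, leaving (x + w)(1
+ x)^r for each predecessor with r free rows. -/
lemma sum_pow_free {R : ColumnRule α} (hR : R.Balanced) (n : ℕ) (x : ℚ) :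
    ∑ T ∈ R.goodTableaux n, x ^ #(R.free T) = ∏ i ∈ range n, (x + R.weight + i) := by
  induction n generalizing x with
  | zero => simp [goodTableaux, free, Tableau.empty]
  | succ n ih =>
    rw [sum_goodTableaux_succ]
    simp only [card_free_addRow, sum_validColumns hR]
    rw [prod_range_succ', Nat.cast_zero, add_zero]
    have h : ∏ i ∈ range n, (x + R.weight + ((i + 1 : ℕ) : ℚ)) =
        ∏ i ∈ range n, ((1 + x) + R.weight + i) :=
      prod_congr rfl fun i _ => by push_cast; ring
    rw [h, ← ih, sum_mul]
    exact sum_congr rfl fun T _ => by ring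

open Classical in
lemma sum_endsWithRow_succ (n : ℕ) (f : ℕ → ℚ) :
    ∑ T ∈ R.goodTableaux (n + 1), (if T.EndsWithRow then f #(R.free T) else 0) =
      ∑ T ∈ R.goodTableaux n, f (#(R.free T) + 1) := by
  rw [sum_goodTableaux_succ]
  simp [Tableau.addRow_endsWithRow, Tableau.not_addCol_endsWithRow, card_free_addRow]

/-- The same cancellation handles the old corners. The second summand counts new ones: they come
from a row step and then a column step on a tableau of length `n`, and the row step raises the
number of free rows by one. -/
lemma sum_card_cornerSet_succ {R : ColumnRule α} (hR : R.Balanced) (n : ℕ) (x : ℚ) :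
    ∑ T ∈ R.goodTableaux (n + 2), (#T.cornerSet : ℚ) * x ^ #(R.free T) =
      (x + R.weight) *
        (∑ T ∈ R.goodTableaux (n + 1), (#T.cornerSet : ℚ) * (1 + x) ^ #(R.free T)) +
      ((x + R.weight) * (1 + x) * ∏ i ∈ range n, (1 + x + R.weight + i) -
        x ^ 2 * ∏ i ∈ range n, (x + R.weight + i)) := by
  classical
  rw [← sum_pow_free hR n (1 + x), ← sum_pow_free hR n x, mul_sum, mul_sum, mul_sum,
    ← sum_sub_distrib]
  have h := R.sum_endsWithRow_succ n
    (fun r => (x + R.weight) * (1 + x) ^ r - x * x ^ r)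
  have key : ∀ T ∈ R.goodTableaux (n + 1),
      (#T.addRow.cornerSet : ℚ) * x ^ #(R.free T.addRow) +
        ∑ c ∈ R.validColumns T, (#(T.addCol c).cornerSet : ℚ) * x ^ #(R.free (T.addCol c)) =
      (x + R.weight) * ((#T.cornerSet : ℚ) * (1 + x) ^ #(R.free T)) +
        if T.EndsWithRow then (x + R.weight) * (1 + x) ^ #(R.free T) - x * x ^ #(R.free T)
        else 0 := by
    intro T _
    simp only [Tableau.card_cornerSet_addRow, card_free_addRow, Tableau.card_cornerSet_addCol]
    rw [← mul_sum, sum_validColumns hR]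
    split_ifs <;> push_cast <;> ring
  rw [sum_goodTableaux_succ, sum_congr rfl key, sum_add_distrib, h]
  congr 1
  exact sum_congr rfl fun T _ => by ring

lemma sum_card_cornerSet_of_le_one {R : ColumnRule α} (n : ℕ) (hn : n ≤ 1) (x : ℚ) :
    ∑ T ∈ R.goodTableaux n, (#T.cornerSet : ℚ) * x ^ #(R.free T) = 0 := by
  have h0 : #(Tableau.empty : Tableau α).cornerSet = 0 := by
    rw [card_eq_zero, eq_empty_iff_forall_notMem]
    intro c hc
    exact absurd ((Tableau.mem_cornerSet _ _).1 hc).1 (by simp [Tableau.empty])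
  have h1 : ¬ (Tableau.empty : Tableau α).EndsWithRow := fun h => absurd h.1 (lt_irrefl 0)
  interval_cases n
  · simp [goodTableaux, h0]
  · rw [sum_goodTableaux_succ]
    simp [goodTableaux, Tableau.card_cornerSet_addRow, Tableau.card_cornerSet_addCol, h0, h1]

lemma sum_card_cornerSet {R : ColumnRule α} (hR : R.Balanced) (n : ℕ) (x : ℚ) :
    ∑ T ∈ R.goodTableaux (n + 1), (#T.cornerSet : ℚ) * x ^ #(R.free T) =
      (∏ i ∈ range (n - 1), (x + R.weight + i)) *
        ∑ m ∈ range n, ((1 + x + m) * (x + R.weight + n - 1) - (x + m) ^ 2) := by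
  induction n generalizing x with
  | zero => simpa using sum_card_cornerSet_of_le_one 1 le_rfl x
  | succ n ih =>
    have hprod : ∀ m : ℕ, (x + R.weight) * ∏ i ∈ range m, (1 + x + R.weight + i) =
        (∏ i ∈ range m, (x + R.weight + i)) * (x + R.weight + m) := fun m => by
      rw [← prod_range_succ, prod_range_succ', Nat.cast_zero, add_zero, mul_comm]
      congr 1
      exact prod_congr rfl fun i _ => by push_cast; ring
    rw [sum_card_cornerSet_succ hR, ih, sum_range_succ', Nat.add_sub_cancel]
    -- Replacing x by 1 + x amounts to shifting m by one; the missing term m = 0 is the extra term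
    -- of the recursion.
    have h1 : ∑ m ∈ range n, ((1 + (1 + x) + m) * (1 + x + R.weight + n - 1) - (1 + x + m) ^ 2) =
        ∑ m ∈ range n, ((1 + x + ((m + 1 : ℕ) : ℚ)) * (x + R.weight + ((n + 1 : ℕ) : ℚ) - 1) -
          (x + ((m + 1 : ℕ) : ℚ)) ^ 2) :=
      sum_congr rfl fun m _ => by push_cast; ring
    rw [h1, mul_right_comm _ (1 + x), hprod n, ← mul_assoc, mul_add]
    -- The exponent range `n - 1` is truncated at `n = 0`, where the sum is empty.
    rcases n with _ | n
    · simp; ring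
    · rw [Nat.add_sub_cancel, hprod n, ← prod_range_succ]
      push_cast
      ring

end Tableaux

end ColumnRule

/-! ### The three rules; permutation and alternative tableaux -/

instance : DecidableEq Arrow
  | .left, .left => isTrue rfl
  | .left, .up => isFalse Arrow.noConfusion
  | .up, .left => isFalse Arrow.noConfusion
  | .up, .up => isTrue rfl

instance : Fintype Arrow := ⟨{.left, .up}, fun a => by cases a <;> simp⟩

/-- The rule for permutation tableaux. -/
def permutationRule : ColumnRule (Fin 2) where
  blank := some 0
  allowed _ a := a.isSome
  kills s a := s && decide (a = some 0)
  needsMark := true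

/-- The rule for alternative tableaux. -/
def alternativeRule : ColumnRule Arrow where
  blank := none
  allowed s a := !(s && decide (a = some Arrow.up))
  kills _ a := decide (a = some Arrow.left)
  needsMark := false

/-- The rule for tree-like tableaux without their first column. -/
def treeRule : ColumnRule Unit where
  blank := none
  allowed _ _ := true
  kills s a := s && a.isSome
  needsMark := true

lemma permutationRule_balanced : permutationRule.Balanced where
  blank_allowed s := rfl
  sum_false x u v := by
    rw [sum_filter, Fintype.sum_option, Fin.sum_univ_two]
    simp [permutationRule, ColumnRule.weight]
  sum_true x := by
    rw [sum_filter, Fintype.sum_option, Fin.sum_univ_two]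
    simp [permutationRule]

lemma sum_arrow (f : Arrow → ℚ) : ∑ a, f a = f Arrow.left + f Arrow.up :=
  sum_pair (by decide)

lemma alternativeRule_balanced : alternativeRule.Balanced where
  blank_allowed s := by simp [alternativeRule]
  sum_false x u v := by
    simp [alternativeRule, ColumnRule.weight, Fintype.sum_option, sum_arrow]
    ring
  sum_true x := by
    simp [alternativeRule, sum_filter, Fintype.sum_option, sum_arrow]
    ring

lemma treeRule_balanced : treeRule.Balanced where
  blank_allowed s := rfl
  sum_false x u v := by
    simp [treeRule, ColumnRule.weight, Fintype.sum_option]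
  sum_true x := by
    simp [treeRule, Fintype.sum_option]
    ring

lemma Tableau.mem_shape_of_fill_eq_some {α : Type} (T : Tableau α) {c : ℕ × ℕ} {a : α}
    (h : T.fill c = some a) : c ∈ T.shape := by
  by_contra hc
  rw [T.fill_eq_none c hc] at h
  exact absurd h (by simp)

lemma fin_two_eq_one_of_ne {a : Option (Fin 2)} (h1 : a ≠ none) (h2 : a ≠ some 0) :
    a = some 1 := by
  revert a
  decide

/-- The forbidden pattern, read from a 0 with a 1 above it, says that every cell to its left is 0,
which is the blank of this rule. -/
lemma isPermutationTableau_iff (T : Tableau (Fin 2)) :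
    IsPermutationTableau T ↔ permutationRule.Good T := by
  constructor
  · intro h
    refine ⟨fun i j hj => Option.isSome_iff_ne_none.2 (h.filled _ hj), fun i j hj hk j' hj' => ?_,
      fun _ j hj => ?_⟩
    · simp only [permutationRule, Bool.and_eq_true, decide_eq_true_eq] at hk ⊢
      obtain ⟨i', hi', hs⟩ := (ColumnRule.seen_eq_true _).1 hk.1
      by_contra hne
      have hl := fin_two_eq_one_of_ne
        (h.filled (i, j') (T.shape.up_left_mem le_rfl hj'.le hj)) hne
      have hu := fin_two_eq_one_of_ne
        (h.filled (i', j) (T.shape.up_left_mem hi'.le le_rfl hj)) hs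
      exact h.not_zero i j hk.2 ⟨⟨i', hi', hu⟩, j', hj', hl⟩
    · obtain ⟨i, hi⟩ := h.exists_one j hj
      exact ⟨i, T.mem_shape_of_fill_eq_some hi, by simp [permutationRule, hi]⟩
  · intro h
    have hf : ∀ c ∈ T.shape, T.fill c ≠ none := fun c hc =>
      Option.isSome_iff_ne_none.1 (h.allowed c.1 c.2 hc)
    have hm : ∀ j < T.numCols, ∃ i, T.fill (i, j) = some 1 := fun j hj => by
      obtain ⟨i, hi, hb⟩ := h.mark rfl j hj
      exact ⟨i, fin_two_eq_one_of_ne (hf _ hi) hb⟩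
    refine ⟨fun j hj => ?_, hf, hm, ?_⟩
    · obtain ⟨i, hi⟩ := hm j hj
      exact (Nat.zero_le i).trans_lt
        (YoungDiagram.mem_iff_lt_colLen.1 (T.mem_shape_of_fill_eq_some hi))
    · rintro i j h0 ⟨⟨i', hi', hu⟩, j', hj', hl⟩
      have := h.killed i j (T.mem_shape_of_fill_eq_some h0) (by
        simp only [permutationRule, h0, decide_true, Bool.and_true]
        exact (ColumnRule.seen_eq_true _).2 ⟨i', hi', by simp [hu]⟩) j' hj'
      rw [hl] at this
      exact absurd this (by decide)

lemma isAlternativeTableau_iff (T : Tableau Arrow) :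
    IsAlternativeTableau T ↔ alternativeRule.Good T := by
  constructor
  · intro h
    refine ⟨fun i j hj => ?_, fun i j hj hk j' hj' => ?_, fun hm => absurd hm (by decide)⟩
    · simp only [alternativeRule, Bool.not_eq_true', Bool.and_eq_false_iff, decide_eq_false_iff_not]
      by_contra hc
      rw [not_or, not_not, Bool.not_eq_false] at hc
      obtain ⟨i', hi', hs⟩ := (ColumnRule.seen_eq_true _).1 hc.1
      exact hs (h.up_empty i j hc.2 i' hi')
    · exact h.left_empty i j (by simpa [alternativeRule] using hk) j' hj'
  · intro h
    refine ⟨fun i j hl j' hj' => ?_, fun i j hu i' hi' => ?_⟩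
    · exact h.killed i j (T.mem_shape_of_fill_eq_some hl) (by simp [alternativeRule, hl]) j' hj'
    · have := h.allowed i j (T.mem_shape_of_fill_eq_some hu)
      simp only [alternativeRule, hu, decide_true, Bool.and_true, Bool.not_eq_true',
        ← Bool.not_eq_true] at this
      by_contra hs
      exact this ((ColumnRule.seen_eq_true _).2 ⟨i', hi', hs⟩)

lemma corners_finite_and_numCorners_eq {α : Type} {X : Set (Tableau α)} {G : Finset (Tableau α)}
    (h : ∀ T, T ∈ X ↔ T ∈ G) :
    (corners X).Finite ∧ numCorners X = ∑ T ∈ G, #T.cornerSet := by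
  classical
  have hX : corners X = (G.biUnion fun T => T.cornerSet.image (Prod.mk T) :
      Finset (Tableau α × (ℕ × ℕ))) := by
    ext ⟨T, c⟩
    rw [mem_coe, mem_biUnion]
    constructor
    · rintro ⟨h1, h2⟩
      exact ⟨T, (h T).1 h1, mem_image.2 ⟨c, (T.mem_cornerSet c).2 h2, rfl⟩⟩
    · rintro ⟨U, hU, hc⟩
      obtain ⟨d, hd, he⟩ := mem_image.1 hc
      cases he
      exact ⟨(h _).2 hU, (Tableau.mem_cornerSet _ _).1 hd⟩
  refine ⟨hX ▸ finite_toSet _, ?_⟩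
  rw [numCorners, hX, Set.ncard_coe_finset, card_biUnion]
  · exact sum_congr rfl fun T _ => card_image_of_injective _ (Prod.mk_right_injective T)
  · intro T _ U _ hTU
    rw [Function.onFun, Finset.disjoint_left]
    intro p h1 h2
    obtain ⟨c, -, rfl⟩ := mem_image.1 h1
    obtain ⟨d, -, h⟩ := mem_image.1 h2
    exact hTU (congrArg Prod.fst h).symm

/-! ### Tree-like tableaux: removing and restoring the first column -/

/-- The first column of a tree-like tableau with remaining columns `T`. -/
noncomputable def treeColumn (T : Tableau Unit) (i : ℕ) : Option Unit :=
  open Classical in if i ∈ treeRule.free T then some () else none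

/-- The tree-like tableau with remaining columns `T`. -/
noncomputable def completeTree (T : Tableau Unit) : Tableau Unit := T.addCol (treeColumn T)

lemma pointed_completeTree_zero (T : Tableau Unit) (i : ℕ) :
    (completeTree T).Pointed (i, 0) ↔ i ∈ treeRule.free T := by
  simp only [Tableau.Pointed, completeTree, Tableau.addCol_fill_zero, treeColumn]
  constructor
  · intro h
    split_ifs at h
    assumption
  · intro h
    rw [if_pos ((ColumnRule.mem_free _).1 h).1, if_pos h]

lemma Tableau.Pointed.mem {T : Tableau Unit} {c : ℕ × ℕ} (h : T.Pointed c) : c ∈ T.shape :=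
  T.mem_shape_of_fill_eq_some h

lemma ne_treeRule_blank {a : Option Unit} : a ≠ treeRule.blank ↔ a = some () := by
  rcases a with _ | ⟨⟩ <;> simp [treeRule]

lemma treeRule_kills {T : Tableau Unit} {i j : ℕ} :
    treeRule.kills (treeRule.seen (fun i' => T.fill (i', j)) i) (T.fill (i, j)) = true ↔
      T.Pointed (i, j) ∧ ∃ i' < i, T.Pointed (i', j) := by
  have h : treeRule.kills (treeRule.seen (fun i' => T.fill (i', j)) i) (T.fill (i, j)) =
    (treeRule.seen (fun i' => T.fill (i', j)) i && (T.fill (i, j)).isSome) := rfl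
  rw [h, Bool.and_eq_true, ColumnRule.seen_eq_true, and_comm]
  refine and_congr ?_ ?_
  · rw [Option.isSome_iff_exists]
    exact ⟨fun ⟨_, h⟩ => h, fun h => ⟨(), h⟩⟩
  · simp only [ne_treeRule_blank, Tableau.Pointed]

lemma mem_free_treeRule {T : Tableau Unit} {i : ℕ} : i ∈ treeRule.free T ↔
    i < T.k ∧ ∀ j, T.Pointed (i, j) → ¬ ∃ i' < i, T.Pointed (i', j) := by
  rw [ColumnRule.mem_free]
  refine and_congr_right fun _ => forall_congr' fun j => ?_
  rw [← Bool.not_eq_true, treeRule_kills, not_and]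
  exact ⟨fun h hp => h hp.mem hp, fun h _ => h⟩

lemma good_treeRule_iff {T : Tableau Unit} : treeRule.Good T ↔
    (∀ i j, T.Pointed (i, j) → (∃ i' < i, T.Pointed (i', j)) → ∀ j' < j, ¬ T.Pointed (i, j')) ∧
      ∀ j < T.numCols, ∃ i, T.Pointed (i, j) := by
  have hb : ∀ c, T.fill c = treeRule.blank ↔ ¬ T.Pointed c := fun c => by
    rw [← not_iff_not, not_not]
    exact ne_treeRule_blank
  constructor
  · rintro ⟨-, h1, h2⟩
    refine ⟨fun i j hp ha j' hj' => (hb _).1 (h1 i j hp.mem (treeRule_kills.2 ⟨hp, ha⟩) j' hj'),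
      fun j hj => ?_⟩
    obtain ⟨i, -, h⟩ := h2 rfl j hj
    exact ⟨i, ne_treeRule_blank.1 h⟩
  · rintro ⟨h1, h2⟩
    refine ⟨fun _ _ _ => rfl, fun i j _ hk j' hj' => ?_, fun _ j hj => ?_⟩
    · obtain ⟨hp, ha⟩ := treeRule_kills.1 hk
      exact (hb _).2 (h1 i j hp ha j' hj')
    · obtain ⟨i, h⟩ := h2 j hj
      exact ⟨i, h.mem, ne_treeRule_blank.2 h⟩

/-- A point outside the first column with none above it needs one to its left. In a free row the
first column supplies it. Otherwise the row contains a point with a point above; nothing in `T` lies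
to the left of such a point, so it is itself on the left. -/
lemma isTreeLikeTableau_completeTree {T : Tableau Unit} (h : treeRule.Good T) (hk : 0 < T.k) :
    IsTreeLikeTableau (completeTree T) := by
  obtain ⟨h1, h2⟩ := good_treeRule_iff.1 h
  have h0 : (completeTree T).Pointed (0, 0) := (pointed_completeTree_zero T 0).2
    (mem_free_treeRule.2 ⟨hk, fun j _ ⟨i', hi', _⟩ => absurd hi' (Nat.not_lt_zero _)⟩)
  have hcol : ∀ j < (completeTree T).numCols, ∃ i, (completeTree T).Pointed (i, j) := by
    intro j hj
    rcases j with _ | j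
    · exact ⟨0, h0⟩
    · rw [completeTree, Tableau.addCol_numCols] at hj
      exact h2 j (by omega)
  have hrow : ∀ i, i < T.k → i ∉ treeRule.free T →
      ∃ j, T.Pointed (i, j) ∧ ∃ i' < i, T.Pointed (i', j) := by
    intro i hi hF
    rw [mem_free_treeRule] at hF
    push Not at hF
    exact hF hi
  refine ⟨fun i hi => ?_, fun j hj => ?_, h0, ?_, fun i hi => ?_, hcol⟩
  · exact YoungDiagram.mem_iff_lt_rowLen.1 ((Tableau.mem_addCol_zero T _ i).2 hi)
  · obtain ⟨i, hi⟩ := hcol j hj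
    exact (Nat.zero_le i).trans_lt (YoungDiagram.mem_iff_lt_colLen.1 hi.mem)
  · intro i j hp hne
    rcases j with _ | j
    · have hi : 0 < i := Nat.pos_of_ne_zero fun h => hne (by rw [h])
      exact Or.inl ⟨⟨0, hi, h0⟩, fun ⟨j', hj', _⟩ => absurd hj' (Nat.not_lt_zero _)⟩
    · have hp : T.Pointed (i, j) := hp
      by_cases ha : ∃ i' < i, T.Pointed (i', j)
      · refine Or.inl ⟨ha, ?_⟩
        rintro ⟨j', hj', hl⟩
        rcases j' with _ | j'
        · exact (mem_free_treeRule.1 ((pointed_completeTree_zero T i).1 hl)).2 j hp ha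
        · exact h1 i j hp ha j' (by omega) hl
      · refine Or.inr ⟨?_, ha⟩
        by_cases hF : i ∈ treeRule.free T
        · exact ⟨0, Nat.succ_pos _, (pointed_completeTree_zero T i).2 hF⟩
        · obtain ⟨j', hp', ha'⟩ := hrow i (T.row_lt hp.mem) hF
          rcases lt_trichotomy j' j with hlt | rfl | hlt
          · exact ⟨j' + 1, by omega, hp'⟩
          · exact absurd ha' ha
          · exact absurd hp (h1 i j' hp' ha' j hlt)
  · by_cases hF : i ∈ treeRule.free T
    · exact ⟨0, (pointed_completeTree_zero T i).2 hF⟩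
    · obtain ⟨j, hj, -⟩ := hrow i hi hF
      exact ⟨j + 1, hj⟩

lemma IsTreeLikeTableau.not_left {T : Tableau Unit} (h : IsTreeLikeTableau T) {i j : ℕ}
    (hp : T.Pointed (i, j)) (ha : ∃ i' < i, T.Pointed (i', j)) : ¬ ∃ j' < j, T.Pointed (i, j') := by
  have hne : (i, j) ≠ (0, 0) := by
    rintro ⟨⟩
    obtain ⟨i', hi', -⟩ := ha
    exact absurd hi' (Nat.not_lt_zero _)
  rcases h.parent i j hp hne with h | h
  · exact h.2
  · exact absurd ha h.2

lemma IsTreeLikeTableau.exists_completeTree_eq {T : Tableau Unit} (h : IsTreeLikeTableau T) :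
    ∃ U : Tableau Unit, treeRule.Good U ∧ 0 < U.k ∧ completeTree U = T := by
  have hk : 0 < T.k := T.row_lt h.root.mem
  have hE : ¬ T.EndsWithRow := fun hE =>
    hE.2 (YoungDiagram.mem_iff_lt_rowLen.2 (h.no_empty_row _ (by omega)))
  have hT := T.exists_addCol_eq hE (by rw [KNDiagram.length_eq]; exact hk.trans_le T.k_le_n)
  have hp : ∀ i j, T.delCol.Pointed (i, j) ↔ T.Pointed (i, j + 1) := fun _ _ => Iff.rfl
  have hn : T.numCols = T.delCol.numCols + 1 := by
    conv_lhs => rw [← hT]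
    rw [Tableau.addCol_numCols]
  refine ⟨T.delCol, good_treeRule_iff.2 ⟨fun i j hij ha j' hj' hl => ?_, fun j hj => ?_⟩, hk, ?_⟩
  · exact h.not_left ((hp i j).1 hij) ha ⟨j' + 1, by omega, hl⟩
  · exact h.col_pointed (j + 1) (by omega)
  · conv_rhs => rw [← hT]
    rw [completeTree]
    congr 1
    funext i
    have key : i ∈ treeRule.free T.delCol ↔ T.Pointed (i, 0) := by
      rw [mem_free_treeRule]
      constructor
      · rintro ⟨hi, hF⟩
        classical
        -- If the leftmost point of row `i` were not in the first column, its parent would lie above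
        -- it and the row would not be free.
        have hex := h.row_pointed i hi
        have hmin := Nat.find_spec hex
        have hlt : ¬ ∃ j' < Nat.find hex, T.Pointed (i, j') := fun ⟨j', hj', hq⟩ =>
          Nat.find_min hex hj' hq
        generalize Nat.find hex = j at hmin hlt
        rcases j with _ | j
        · exact hmin
        · rcases h.parent i (j + 1) hmin (by simp) with hx | hx
          · exact absurd hx.1 (hF j hmin)
          · exact absurd hx.1 hlt
      · intro h0
        exact ⟨T.row_lt h0.mem, fun j hj ha => h.not_left ((hp i j).1 hj) ha
          ⟨0, Nat.succ_pos _, h0⟩⟩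
    rw [treeColumn]
    split_ifs with hF
    · exact (key.1 hF).symm
    · rw [key] at hF
      rcases hv : T.fill (i, 0) with _ | ⟨⟩
      · rfl
      · exact absurd hv hF

/-- Every column has one topmost point (`A`) and every row one leftmost point (`B`). By the parent
condition each point is of exactly one kind, except the root, which is of both. -/
lemma IsTreeLikeTableau.size_add_one {T : Tableau Unit} (h : IsTreeLikeTableau T) :
    T.size + 1 = T.length := by
  classical
  have hP : ∀ c, (T.fill c).isSome = true ↔ T.Pointed c := fun c => by
    rw [Option.isSome_iff_exists]
    exact ⟨fun ⟨_, h⟩ => h, fun h => ⟨(), h⟩⟩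
  set P := T.shape.cells.filter fun c => (T.fill c).isSome with hPdef
  have memP : ∀ c, c ∈ P ↔ T.Pointed c := fun c => by
    rw [hPdef, mem_filter, hP, YoungDiagram.mem_cells]
    exact ⟨fun h => h.2, fun h => ⟨h.mem, h⟩⟩
  set A := P.filter fun c => ¬ ∃ i' < c.1, T.Pointed (i', c.2)
  set B := P.filter fun c => ¬ ∃ j' < c.2, T.Pointed (c.1, j')
  have hA : #A = T.numCols := by
    rw [← card_range T.numCols]
    refine card_bij (fun c _ => c.2) ?_ ?_ ?_
    · intro c hc
      exact mem_range.2 (T.col_lt ((memP c).1 (mem_filter.1 hc).1).mem)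
    · rintro ⟨a, b⟩ h1 ⟨c, d⟩ h2 rfl
      rw [mem_filter, memP] at h1 h2
      rcases lt_trichotomy a c with hlt | rfl | hlt
      · exact absurd ⟨a, hlt, h1.1⟩ h2.2
      · rfl
      · exact absurd ⟨c, hlt, h2.1⟩ h1.2
    · intro j hj
      have hex := h.col_pointed j (mem_range.1 hj)
      exact ⟨(Nat.find hex, j), mem_filter.2 ⟨(memP _).2 (Nat.find_spec hex),
        fun ⟨i', hi', hq⟩ => Nat.find_min hex hi' hq⟩, rfl⟩
  have hB : #B = T.k := by
    rw [← card_range T.k]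
    refine card_bij (fun c _ => c.1) ?_ ?_ ?_
    · intro c hc
      exact mem_range.2 (T.row_lt ((memP c).1 (mem_filter.1 hc).1).mem)
    · rintro ⟨a, b⟩ h1 ⟨c, d⟩ h2 rfl
      rw [mem_filter, memP] at h1 h2
      rcases lt_trichotomy b d with hlt | rfl | hlt
      · exact absurd ⟨b, hlt, h1.1⟩ h2.2
      · rfl
      · exact absurd ⟨d, hlt, h2.1⟩ h1.2
    · intro i hi
      have hex := h.row_pointed i (mem_range.1 hi)
      exact ⟨(i, Nat.find hex), mem_filter.2 ⟨(memP _).2 (Nat.find_spec hex),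
        fun ⟨i', hi', hq⟩ => Nat.find_min hex hi' hq⟩, rfl⟩
  have hU : A ∪ B = P := by
    rw [← filter_or]
    refine filter_true_of_mem fun c hc => ?_
    by_cases hc0 : c = (0, 0)
    · subst hc0
      exact Or.inl fun ⟨i', hi', _⟩ => absurd hi' (Nat.not_lt_zero _)
    · rcases h.parent c.1 c.2 ((memP c).1 hc) hc0 with hx | hx
      · exact Or.inr hx.2
      · exact Or.inl hx.2
  have hI : A ∩ B = {(0, 0)} := by
    rw [← filter_and]
    ext c
    rw [mem_filter, memP, mem_singleton]
    constructor
    · rintro ⟨h1, h2, h3⟩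
      by_contra hc0
      rcases h.parent c.1 c.2 h1 hc0 with hx | hx
      · exact h2 hx.1
      · exact h3 hx.1
    · rintro rfl
      exact ⟨h.root, fun ⟨i', hi', _⟩ => absurd hi' (Nat.not_lt_zero _),
        fun ⟨i', hi', _⟩ => absurd hi' (Nat.not_lt_zero _)⟩
  have := card_union_add_card_inter A B
  rw [hU, hI, card_singleton, hA, hB] at this
  rw [KNDiagram.length, Tableau.size, ← hPdef]
  omega

open Classical in
lemma mem_treeLikeTableaux {n : ℕ} (hn : 1 ≤ n) (T : Tableau Unit) :
    T ∈ treeLikeTableaux n ↔ T ∈ (treeRule.goodTableaux n).image completeTree := by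
  simp only [mem_image, ColumnRule.mem_goodTableaux treeRule_balanced]
  have hlen : ∀ U : Tableau Unit, (completeTree U).length = U.length + 1 := fun U =>
    U.addCol_length _
  constructor
  · rintro ⟨h, hs⟩
    obtain ⟨U, hU, -, rfl⟩ := h.exists_completeTree_eq
    have := h.size_add_one
    rw [hlen] at this
    exact ⟨U, ⟨hU, by omega⟩, rfl⟩
  · rintro ⟨U, ⟨hU, hl⟩, rfl⟩
    -- Without rows, positive length would give a column, which could not contain a point.
    have hk : 0 < U.k := by
      by_contra hk
      have h0 : U.k = 0 := by omega
      obtain ⟨i, hi⟩ := (good_treeRule_iff.1 hU).2 0 (by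
        rw [KNDiagram.length_eq] at hl
        rw [KNDiagram.numCols]
        omega)
      have := U.row_lt hi.mem
      omega
    have h := isTreeLikeTableau_completeTree hU hk
    have := h.size_add_one
    rw [hlen] at this
    exact ⟨h, by omega⟩

open Classical in
lemma numCorners_treeLikeTableaux {n : ℕ} (hn : 1 ≤ n) :
    (corners (treeLikeTableaux n)).Finite ∧ (numCorners (treeLikeTableaux n) : ℚ) =
      ∑ T ∈ treeRule.goodTableaux n, (#T.cornerSet : ℚ) +
        ∑ T ∈ treeRule.goodTableaux n, if T.EndsWithRow then 1 else 0 := by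
  obtain ⟨h1, h2⟩ := corners_finite_and_numCorners_eq (mem_treeLikeTableaux hn)
  refine ⟨h1, ?_⟩
  rw [h2, sum_image]
  · simp only [completeTree, Tableau.card_cornerSet_addCol]
    push_cast
    exact sum_add_distrib
  · intro T _ U _ h
    rw [← T.delCol_addCol (treeColumn T), ← U.delCol_addCol (treeColumn U)]
    exact congrArg Tableau.delCol h

/-! ### Evaluation at x = 1 -/

lemma prod_one_add_range (n : ℕ) : ∏ i ∈ range n, (1 + (i : ℚ)) = (n.factorial : ℚ) := by
  rw [← prod_range_add_one_eq_factorial]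
  push_cast
  exact prod_congr rfl fun i _ => add_comm _ _

lemma prod_two_add_range (n : ℕ) : ∏ i ∈ range n, (1 + 1 + (i : ℚ)) = ((n + 1).factorial : ℚ) := by
  rw [← prod_one_add_range, prod_range_succ']
  simp only [Nat.cast_zero, add_zero, mul_one]
  exact prod_congr rfl fun i _ => by push_cast; ring

lemma sum_corner_weights (n : ℕ) (a : ℚ) :
    ∑ m ∈ range n, ((1 + 1 + (m : ℚ)) * a - (1 + m) ^ 2) =
      a * (n * (n + 3) / 2) - n * (n + 1) * (2 * n + 1) / 6 := by
  induction n with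
  | zero => simp
  | succ n ih =>
    rw [sum_range_succ, ih]
    push_cast
    ring

lemma sum_card_cornerSet_weight_zero {α : Type} [DecidableEq α] [Fintype α] {R : ColumnRule α}
    (hR : R.Balanced) (hw : R.weight = 0) (n : ℕ) :
    ∑ T ∈ R.goodTableaux (n + 2), (#T.cornerSet : ℚ) =
      ((n + 1).factorial : ℚ) * ((((n + 2 : ℕ) : ℚ) ^ 2 + 4 * ((n + 2 : ℕ) : ℚ) - 6) / 6) := by
  have h := ColumnRule.sum_card_cornerSet hR (n + 1) 1
  simp only [one_pow, mul_one, hw, add_zero, Nat.add_sub_cancel, prod_one_add_range] at h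
  rw [h, Nat.factorial_succ, sum_corner_weights]
  push_cast
  ring

/-- Alternative tableaux are indexed by length n - 1 in the theorem, hence `n + 2` on the right for
length `n + 1`. -/
lemma sum_card_cornerSet_weight_one {α : Type} [DecidableEq α] [Fintype α] {R : ColumnRule α}
    (hR : R.Balanced) (hw : R.weight = 1) (n : ℕ) :
    ∑ T ∈ R.goodTableaux (n + 1), (#T.cornerSet : ℚ) =
      ((n + 1).factorial : ℚ) * ((((n + 2 : ℕ) : ℚ) ^ 2 + 4 * ((n + 2 : ℕ) : ℚ) - 12) / 6) := by
  have h := ColumnRule.sum_card_cornerSet hR n 1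
  simp only [one_pow, mul_one, hw, prod_two_add_range] at h
  rw [h, sum_corner_weights]
  rcases n with _ | n
  · norm_num
  · rw [Nat.add_sub_cancel, Nat.factorial_succ (n + 1)]
    push_cast
    ring

lemma sum_card_cornerSet_of_le_one {α : Type} [DecidableEq α] [Fintype α] (R : ColumnRule α)
    {n : ℕ} (hn : n ≤ 1) : ∑ T ∈ R.goodTableaux n, (#T.cornerSet : ℚ) = 0 := by
  simpa using ColumnRule.sum_card_cornerSet_of_le_one (R := R) n hn 1

open Classical in
lemma sum_endsWithRow_weight_zero {α : Type} [DecidableEq α] [Fintype α] {R : ColumnRule α}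
    (hR : R.Balanced) (hw : R.weight = 0) (n : ℕ) :
    ∑ T ∈ R.goodTableaux (n + 1), (if T.EndsWithRow then 1 else 0 : ℚ) = (n.factorial : ℚ) := by
  rw [R.sum_endsWithRow_succ n fun _ => 1, ← prod_one_add_range]
  have h := ColumnRule.sum_pow_free hR n 1
  simpa [hw] using h

end TypeATableaux

theorem mainTheorem1 (n : ℕ) (hn : 1 ≤ n) :
    ((TypeATableaux.corners (TypeATableaux.permutationTableaux n)).Finite ∧
      (TypeATableaux.numCorners (TypeATableaux.permutationTableaux n) : ℚ) =
        if n = 1 then 0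
        else (Nat.factorial (n - 1) : ℚ) * (((n : ℚ) ^ 2 + 4 * (n : ℚ) - 6) / 6)) ∧
    ((TypeATableaux.corners (TypeATableaux.alternativeTableaux (n - 1))).Finite ∧
      (TypeATableaux.numCorners (TypeATableaux.alternativeTableaux (n - 1)) : ℚ) =
        if n = 1 then 0
        else (Nat.factorial (n - 1) : ℚ) * (((n : ℚ) ^ 2 + 4 * (n : ℚ) - 12) / 6)) ∧
    ((TypeATableaux.corners (TypeATableaux.treeLikeTableaux n)).Finite ∧
      (TypeATableaux.numCorners (TypeATableaux.treeLikeTableaux n) : ℚ) =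
        if n = 1 then 1
        else (Nat.factorial n : ℚ) * (((n : ℚ) + 4) / 6)) := by
  open TypeATableaux in
  have hp := corners_finite_and_numCorners_eq (X := permutationTableaux n)
    (G := permutationRule.goodTableaux n) fun T => by
      rw [ColumnRule.mem_goodTableaux permutationRule_balanced, ← isPermutationTableau_iff]
      rfl
  have ha := corners_finite_and_numCorners_eq (X := alternativeTableaux (n - 1))
    (G := alternativeRule.goodTableaux (n - 1)) fun T => by
      rw [ColumnRule.mem_goodTableaux alternativeRule_balanced, ← isAlternativeTableau_iff]
      rfl
  obtain ⟨ht1, ht2⟩ := numCorners_treeLikeTableaux hn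
  refine ⟨⟨hp.1, ?_⟩, ⟨ha.1, ?_⟩, ht1, ?_⟩
  · rw [hp.2, Nat.cast_sum]
    split_ifs with h
    · exact sum_card_cornerSet_of_le_one _ h.le
    · obtain ⟨m, rfl⟩ := Nat.exists_eq_add_of_le' (show 2 ≤ n by omega)
      exact sum_card_cornerSet_weight_zero permutationRule_balanced rfl m
  · rw [ha.2, Nat.cast_sum]
    split_ifs with h
    · exact sum_card_cornerSet_of_le_one _ (by omega)
    · obtain ⟨m, rfl⟩ := Nat.exists_eq_add_of_le' (show 2 ≤ n by omega)
      exact sum_card_cornerSet_weight_one alternativeRule_balanced rfl m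
  · rw [ht2]
    split_ifs with h
    · subst h
      rw [sum_card_cornerSet_of_le_one _ le_rfl, sum_endsWithRow_weight_zero treeRule_balanced rfl 0]
      norm_num
    · obtain ⟨m, rfl⟩ := Nat.exists_eq_add_of_le' (show 2 ≤ n by omega)
      -- The additional (n-1)! corners of the restored first columns turn n^2 + 4n - 6 into n(n +
      -- 4).
      rw [sum_card_cornerSet_weight_zero treeRule_balanced rfl m,
        sum_endsWithRow_weight_zero treeRule_balanced rfl (m + 1), Nat.factorial_succ (m + 1)]
      push_cast
      ring
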